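/- **Definitions.** A metric space $X$ has finite asymptotic dimension if there is $m\in\mathbb N$ such that for every $d>0$ there is a uniformly bounded cover of $X$ with the property that every ball of radius $d$ in $X$ meets at most $m+1$ members of the cover. An isometric action of a discrete group $\Gamma$ on a metric space $X$ is metrically proper if for every bounded $Y\subseteq X$ the set $\{g\in\Gamma : gY\cap Y\neq\emptyset\}$ is finite. An action of a discrete group $\Gamma$ on a space $X$ is proper if there are finite subgroups $H_i\le\Gamma$ and $H_i$-invariant subspaces $X_i\subseteq X$ ($i\in I$) such that the natural maps $\Gamma\times_{H_i}X_i\to X$, $[g,x]\mapsto gx$, are homeomorphisms onto their images and these images cover $X$. A subgroup $\Gamma\le SL(n,\mathbb C)$ has integral characteristic if all coefficients of the characteristic polynomial of every element of $\Gamma$ are algebraic integers. **Theorem.** Let $G$ be a finitely generated subgroup of $SL(n,\mathbb C)$. There exist a non-empty metric space $X$ of finite asymptotic dimension and an action of $G$ on $X$ by isometries such that for every subgroup $\Gamma\le G$ that has integral characteristic and acts irreducibly on $\mathbb C^n$, the restriction to $\Gamma$ of the action on $X$ is metrically proper and proper. -/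

import Mathlib

universe u v

/-- `X` has asymptotic dimension at most `m`: for every `d > 0` there is a uniformly bounded cover
of `X` such that every ball of radius `d` meets at most `m + 1` members of the cover. -/
def AsdimLE (X : Type u) [MetricSpace X] (m : ℕ) : Prop :=
  ∀ d : ℝ, 0 < d → ∃ 𝒰 : Set (Set X),
    ⋃₀ 𝒰 = Set.univ ∧
    (∃ D : ℝ, ∀ U ∈ 𝒰, ∀ x ∈ U, ∀ y ∈ U, dist x y ≤ D) ∧
    ∀ x : X, {U | U ∈ 𝒰 ∧ (Metric.ball x d ∩ U).Nonempty}.encard ≤ (m : ℕ∞) + 1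

/-- `X` has finite asymptotic dimension. -/
def HasFiniteAsdim (X : Type u) [MetricSpace X] : Prop :=
  ∃ m : ℕ, AsdimLE X m

/-- An action of a (discrete) group `Γ` on a metric space `X` is metrically proper: it is isometric,
and for every bounded `Y ⊆ X` only finitely many `g ∈ Γ` satisfy `g Y ∩ Y ≠ ∅`. -/
def IsMetricallyProperAction (Γ : Type v) [Group Γ] (X : Type u) [MetricSpace X]
    [MulAction Γ X] : Prop :=
  (∀ g : Γ, Isometry (fun x : X => g • x)) ∧
  ∀ Y : Set X, Bornology.IsBounded Y →
    {g : Γ | (((fun x : X => g • x) '' Y) ∩ Y).Nonempty}.Finite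

/-- The equivalence relation `(g, y) ∼ (g h⁻¹, h y)`, `h ∈ H`, on `Γ × Y`. -/
def balancedSetoid {Γ : Type v} [Group Γ] {X : Type u} [MulAction Γ X]
    (H : Subgroup Γ) (Y : Set X) : Setoid (Γ × Y) where
  r p q := ∃ h ∈ H, q.1 = p.1 * h⁻¹ ∧ (q.2 : X) = h • (p.2 : X)
  iseqv :=
    { refl := fun p => ⟨1, H.one_mem, by simp, by simp⟩
      symm := by
        rintro p q ⟨h, hh, h1, h2⟩
        exact ⟨h⁻¹, H.inv_mem hh, by simp [h1], by simp [h2]⟩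
      trans := by
        rintro p q r ⟨h, hh, h1, h2⟩ ⟨k, hk, k1, k2⟩
        exact ⟨k * h, H.mul_mem hk hh, by simp [k1, h1, mul_assoc], by simp [k2, h2, mul_smul]⟩ }

/-- The balanced product `Γ ×_H Y`. -/
def BalancedProduct {Γ : Type v} [Group Γ] {X : Type u} [MulAction Γ X]
    (H : Subgroup Γ) (Y : Set X) : Type (max u v) :=
  Quotient (balancedSetoid H Y)

/-- The quotient map `Γ × Y → Γ ×_H Y`. -/
def BalancedProduct.mk {Γ : Type v} [Group Γ] {X : Type u} [MulAction Γ X]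
    (H : Subgroup Γ) (Y : Set X) (p : Γ × Y) : BalancedProduct H Y :=
  Quotient.mk (balancedSetoid H Y) p

/-- The quotient topology on `Γ ×_H Y`, where `Γ` is discrete and `Y` has the subspace topology. -/
instance BalancedProduct.instTopologicalSpace {Γ : Type v} [Group Γ] {X : Type u}
    [TopologicalSpace X] [MulAction Γ X] (H : Subgroup Γ) (Y : Set X) :
    TopologicalSpace (BalancedProduct H Y) :=
  TopologicalSpace.coinduced (BalancedProduct.mk H Y)
    (@instTopologicalSpaceProd Γ Y ⊥ inferInstance)

/-- The natural `Γ`-map `Γ ×_H Y → X`, `[g, y] ↦ g y`. -/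
def BalancedProduct.toSpace {Γ : Type v} [Group Γ] {X : Type u} [MulAction Γ X]
    (H : Subgroup Γ) (Y : Set X) : BalancedProduct H Y → X :=
  Quotient.lift (fun p : Γ × Y => p.1 • (p.2 : X)) (by
    rintro p q ⟨h, -, h1, h2⟩
    simp [h1, h2, mul_smul])

/-- An action of a discrete group `Γ` on a space `X` is proper: there are finite subgroups `H i` of
`Γ` and `H i`-invariant subspaces `S i` of `X` such that the natural maps `Γ ×_{H i} S i → X` are
homeomorphisms onto their images, and these images cover `X`. -/
def IsProperAction (Γ : Type v) [Group Γ] (X : Type u) [TopologicalSpace X]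
    [MulAction Γ X] : Prop :=
  ∃ (I : Type u) (H : I → Subgroup Γ) (S : I → Set X),
    (∀ i, Finite (H i)) ∧
    (∀ i, ∀ h ∈ H i, ∀ y ∈ S i, h • y ∈ S i) ∧
    (∀ i, Topology.IsEmbedding (BalancedProduct.toSpace (H i) (S i))) ∧
    ⋃ i, Set.range (BalancedProduct.toSpace (H i) (S i)) = Set.univ

/-- A subgroup of `SL(n, ℂ)` has integral characteristic if the coefficients of the characteristic
polynomial of each of its elements are algebraic integers. -/
def HasIntegralCharacteristic {n : ℕ}
    (Γ : Subgroup (Matrix.SpecialLinearGroup (Fin n) ℂ)) : Prop :=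
  ∀ g ∈ Γ, ∀ k : ℕ, IsIntegral ℤ ((g : Matrix (Fin n) (Fin n) ℂ).charpoly.coeff k)

/-- The natural representation on `ℂⁿ` of a subgroup of `SL(n, ℂ)`. -/
noncomputable def naturalRep {n : ℕ} (Γ : Subgroup (Matrix.SpecialLinearGroup (Fin n) ℂ)) :
    Representation ℂ Γ (Fin n → ℂ) where
  toFun g := Matrix.toLin' ((g : Matrix.SpecialLinearGroup (Fin n) ℂ) : Matrix (Fin n) (Fin n) ℂ)
  map_one' := by simp; rfl
  map_mul' g h := by simp [Matrix.toLin'_mul]; rfl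

/-- A subgroup of `SL(n, ℂ)` acts irreducibly on `ℂⁿ`. -/
def ActsIrreducibly {n : ℕ} (Γ : Subgroup (Matrix.SpecialLinearGroup (Fin n) ℂ)) : Prop :=
  (naturalRep Γ).IsIrreducible

/-! The space is `G` itself with a left-invariant metric, so the point is to find a length function
`ℓ` of finite asymptotic dimension that is proper on every irreducible subgroup with integral
characteristic.

The entries of `G` lie in a finitely generated `ℚ`-algebra `A ⊆ ℂ`, and Zariski's lemma gives a
homomorphism `φ` from `A` to a number field `F`. Each embedding `σ : F → ℂ` yields a representation
`ρ σ` of `G` in `GL_n(ℂ)`, and `ℓ` is the sum over `σ` of the logarithmic operator size of `ρ σ g`.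
Since `GL_n(ℂ)` with this size has finite asymptotic dimension
(`hasBoundedMultiplicityPartitions_log_gauge`), so does `G`, by pulling back and taking common
refinements.

For properness, Burnside's theorem and the trace form give finitely many `γ i ∈ Γ` such that `g` is
determined by the traces of the `g * γ i`. On `Γ` these are algebraic integers, and a bound on `ℓ g`
bounds all conjugates of their images in `F`, which leaves finitely many images. Although `φ` need
not be injective, it is so on algebraic integers: a non-zero element of `A` algebraic over `ℚ` is a
unit of `A`. Hence only finitely many `g` remain. -/

/-! ### Partitions of bounded multiplicity. -/

/-- A function `δ : X → X → ℝ`, thought of as a pseudo-distance, admits partitions of bounded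
multiplicity: for a fixed `m` and every `d` there is a partition of `X` into uniformly bounded
pieces (the fibres of `f`) such that every ball of radius `d` meets at most `m` of them. -/
def HasBoundedMultiplicityPartitions {X : Type u} (δ : X → X → ℝ) : Prop :=
  ∃ m : ℕ, ∀ d : ℝ, ∃ (J : Type u) (f : X → J),
    (∃ D : ℝ, ∀ x y, f x = f y → δ x y ≤ D) ∧
    ∀ x, ∃ s : Finset J, s.card ≤ m ∧ ∀ y, δ x y ≤ d → f y ∈ s

namespace HasBoundedMultiplicityPartitions

theorem comp {X Y : Type u} {δ : Y → Y → ℝ} (h : HasBoundedMultiplicityPartitions δ)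
    (p : X → Y) : HasBoundedMultiplicityPartitions fun x y => δ (p x) (p y) := by
  obtain ⟨m, hm⟩ := h
  refine ⟨m, fun d => ?_⟩
  obtain ⟨J, f, ⟨D, hD⟩, hf⟩ := hm d
  refine ⟨J, f ∘ p, ⟨D, fun x y h => hD _ _ h⟩, fun x => ?_⟩
  obtain ⟨s, hs, hs'⟩ := hf (p x)
  exact ⟨s, hs, fun y hy => hs' _ hy⟩

/-- The common refinement works: diameters add and multiplicities multiply. Non-negativity puts a
ball for the sum inside the ball of the same radius for each summand. -/
theorem sum {X : Type u} {ι : Type u} [Fintype ι] {δ : ι → X → X → ℝ}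
    (h0 : ∀ i x y, 0 ≤ δ i x y) (h : ∀ i, HasBoundedMultiplicityPartitions (δ i)) :
    HasBoundedMultiplicityPartitions fun x y => ∑ i, δ i x y := by
  classical
  choose m hm using h
  refine ⟨∏ i, m i, fun d => ?_⟩
  choose J f hD hf using fun i => hm i d
  choose D hD using hD
  refine ⟨∀ i, J i, fun x i => f i x, ⟨∑ i, D i, fun x y hxy =>
    Finset.sum_le_sum fun i _ => hD i x y (congrFun hxy i)⟩, fun x => ?_⟩
  choose s hs hs' using fun i => hf i x
  refine ⟨Fintype.piFinset s, ?_, fun y hy => ?_⟩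
  · rw [Fintype.card_piFinset]
    exact Finset.prod_le_prod' fun i _ => hs i
  · rw [Fintype.mem_piFinset]
    exact fun i => hs' i y
      ((Finset.single_le_sum (fun j _ => h0 j x y) (Finset.mem_univ i)).trans hy)

theorem hasFiniteAsdim {X : Type u} [MetricSpace X] {δ : X → X → ℝ}
    (h : HasBoundedMultiplicityPartitions δ) (c : ℝ) (hle : ∀ x y, δ x y ≤ dist x y)
    (hge : ∀ x y, dist x y ≤ δ x y + c) : HasFiniteAsdim X := by
  classical
  obtain ⟨m, hm⟩ := h
  refine ⟨m, fun d _ => ?_⟩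
  obtain ⟨J, f, ⟨D, hD⟩, hf⟩ := hm d
  refine ⟨Set.range fun j => f ⁻¹' {j}, ?_, ⟨D + c, ?_⟩, fun x => ?_⟩
  · exact Set.eq_univ_of_forall fun x => ⟨f ⁻¹' {f x}, ⟨f x, rfl⟩, rfl⟩
  · rintro _ ⟨j, rfl⟩ x hx y hy
    exact (hge x y).trans (by gcongr; exact hD x y (hx.trans hy.symm))
  · obtain ⟨s, hs, hs'⟩ := hf x
    have hsub : {U | (U ∈ Set.range fun j => f ⁻¹' {j}) ∧ (Metric.ball x d ∩ U).Nonempty} ⊆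
        ((s.image fun j => f ⁻¹' {j} : Finset (Set X)) : Set (Set X)) := by
      rintro _ ⟨⟨j, rfl⟩, y, hy, hj⟩
      have hj : f y = j := hj
      rw [Metric.mem_ball, dist_comm] at hy
      have := hs' y ((hle x y).trans hy.le)
      rw [Finset.coe_image]
      exact ⟨j, hj ▸ this, rfl⟩
    calc _ ≤ _ := Set.encard_le_encard hsub
      _ = ((s.image fun j => f ⁻¹' {j}).card : ℕ∞) := Set.encard_coe_eq_coe_finsetCard _
      _ ≤ (m : ℕ∞) := by exact_mod_cast Finset.card_image_le.trans hs
      _ ≤ _ := le_self_add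

end HasBoundedMultiplicityPartitions

/-! ### From a length function to a proper isometric action. -/

/-- An action with finite stabilizers on a discrete space is proper. -/
theorem isProperAction_of_discreteTopology {Γ : Type v} [Group Γ] {X : Type u} [TopologicalSpace X]
    [DiscreteTopology X] [MulAction Γ X] (h : ∀ x : X, Finite (MulAction.stabilizer Γ x)) :
    IsProperAction Γ X := by
  refine ⟨X, fun x => MulAction.stabilizer Γ x, fun x => {x}, h, ?_, fun x => ?_, ?_⟩
  · rintro x g hg _ rfl
    exact hg
  -- With a one-point slice, the balanced product is a quotient of a discrete space, so only
  -- injectivity remains to be checked.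
  · have hdisc : DiscreteTopology (BalancedProduct (MulAction.stabilizer Γ x) {x}) := by
      refine discreteTopology_iff_forall_isOpen.mpr fun s => ?_
      rw [isOpen_coinduced]
      let : TopologicalSpace Γ := ⊥
      have : DiscreteTopology Γ := ⟨rfl⟩
      exact isOpen_discrete _
    refine (Topology.IsOpenEmbedding.of_continuous_injective_isOpenMap
      continuous_of_discreteTopology ?_ fun s _ => isOpen_discrete _).isEmbedding
    rintro ⟨g, y, rfl⟩ ⟨g', y', hy'⟩ hgg
    obtain rfl : y' = y := hy'
    have hgg : g • y' = g' • y' := hgg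
    refine Quotient.sound ⟨g'⁻¹ * g, ?_, by simp, ?_⟩
    · simp [MulAction.mem_stabilizer_iff, mul_smul, hgg]
    · simp [mul_smul, hgg]
  · refine Set.eq_univ_of_forall fun x => Set.mem_iUnion.mpr
      ⟨x, BalancedProduct.mk _ _ (1, ⟨x, rfl⟩), ?_⟩
    exact one_smul Γ x

/-- The left-invariant metric on a group determined by a length function, made uniformly discrete
by adding `1` to the distance of distinct points. -/
noncomputable abbrev MetricSpace.ofLength {G : Type u} [Group G] [DecidableEq G]
    (ℓ : G → ℝ) (h1 : ℓ 1 = 0)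
    (h0 : ∀ g, 0 ≤ ℓ g) (hinv : ∀ g, ℓ g⁻¹ = ℓ g) (hmul : ∀ g h, ℓ (g * h) ≤ ℓ g + ℓ h) :
    MetricSpace G :=
  { dist := fun g h => (if g = h then 0 else 1) + ℓ (g⁻¹ * h)
    dist_self := fun g => by simp [h1]
    dist_comm := fun g h => by
      have : ℓ (g⁻¹ * h) = ℓ (h⁻¹ * g) := by rw [← hinv]; simp
      simp only [this, eq_comm (a := g)]
    dist_triangle := fun x y z => by
      have h3 : ℓ (x⁻¹ * z) ≤ ℓ (x⁻¹ * y) + ℓ (y⁻¹ * z) := by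
        simpa [mul_assoc] using hmul (x⁻¹ * y) (y⁻¹ * z)
      have h4 : (if x = z then (0 : ℝ) else 1) ≤
          (if x = y then 0 else 1) + if y = z then 0 else 1 := by
        split_ifs <;> simp_all
      linarith
    eq_of_dist_eq_zero := fun {x y} h => by
      by_contra hne
      have := h0 (x⁻¹ * y)
      simp only [hne, if_false] at h
      linarith }

/-- A group with a length function whose associated pseudo-distance admits partitions of bounded
multiplicity acts by isometries on a metric space of finite asymptotic dimension, in such a way
that the action of every subgroup on which the length is proper is proper and metrically proper. -/
theorem exists_metricSpace_of_length {G : Type u} [Group G] (ℓ : G → ℝ) (h1 : ℓ 1 = 0)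
    (h0 : ∀ g, 0 ≤ ℓ g) (hinv : ∀ g, ℓ g⁻¹ = ℓ g) (hmul : ∀ g h, ℓ (g * h) ≤ ℓ g + ℓ h)
    (hp : HasBoundedMultiplicityPartitions fun g h : G => ℓ (g⁻¹ * h)) :
    ∃ (X : Type u) (_ : MetricSpace X) (_ : Nonempty X) (_ : MulAction G X),
      (∀ g : G, Isometry (fun x : X => g • x)) ∧ HasFiniteAsdim X ∧
      ∀ Γ : Subgroup G, (∀ c : ℝ, {g : G | g ∈ Γ ∧ ℓ g ≤ c}.Finite) →
        IsMetricallyProperAction Γ X ∧ IsProperAction Γ X := by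
  classical
  -- The space is `G` under left translation. The added `1` separates points at which the length
  -- vanishes and makes the topology discrete, so properness of the action follows from its
  -- freeness.
  let _ := MetricSpace.ofLength ℓ h1 h0 hinv hmul
  have hdist : ∀ x y : G, dist x y = (if x = y then 0 else 1) + ℓ (x⁻¹ * y) := by
    intro x y
    rfl
  have hle : ∀ x y : G, ℓ (x⁻¹ * y) ≤ dist x y := fun x y => by
    rw [hdist]; split_ifs <;> simp
  have hisom : ∀ g : G, Isometry (fun x : G => g • x) := fun g => by
    refine Isometry.of_dist_eq fun x y => ?_
    simp [hdist, mul_assoc]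
  refine ⟨G, inferInstance, ⟨1⟩, inferInstance, hisom, ?_, fun Γ hΓ => ⟨⟨fun g => hisom g, ?_⟩, ?_⟩⟩
  · refine hp.hasFiniteAsdim 1 hle fun x y => ?_
    rw [hdist, add_comm]
    gcongr
    split_ifs <;> simp
  · intro Y hY
    obtain ⟨c, hc⟩ := hY.subset_closedBall 1
    refine Set.Finite.of_finite_image (f := Subtype.val) ((hΓ (c + c)).subset ?_)
      Subtype.val_injective.injOn
    rintro _ ⟨g, ⟨_, ⟨y, hy, rfl⟩, hgy⟩, rfl⟩
    refine ⟨g.2, ?_⟩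
    -- Both factors have length at most `c`, because `y` and `g • y` lie within `c` of `1`.
    have e : (g : G) = (1⁻¹ * (g • y)) * (y⁻¹ * 1) := by
      simp [Subgroup.smul_def]
    rw [e]
    refine (hmul _ _).trans (add_le_add ?_ ?_)
    · exact (hle _ _).trans (by simpa [dist_comm] using hc hgy)
    · exact (hle _ _).trans (by simpa using hc hy)
  · have : DiscreteTopology G := by
      refine DiscreteTopology.of_forall_le_dist one_pos fun x y hxy => ?_
      change 1 ≤ dist x y
      rw [hdist, if_neg hxy]
      linarith [h0 (x⁻¹ * y)]
    refine isProperAction_of_discreteTopology fun x => ?_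
    have : MulAction.stabilizer Γ x = ⊥ := by
      refine (Subgroup.eq_bot_iff_forall _).mpr fun g hg => ?_
      have hg : (g : G) * x = x := hg
      exact Subtype.ext (by simpa using hg)
    rw [this]
    infer_instance

/-! ### The gauge of a unit, and nets in unit groups. -/

namespace Units

variable {R : Type u} [NormedRing R]

/-- The symmetric, submultiplicative size `max 1 (max ‖a‖ ‖a⁻¹‖)` of a unit of a normed ring. -/
noncomputable def gauge (a : Rˣ) : ℝ := max 1 (max ‖(a : R)‖ ‖((a⁻¹ : Rˣ) : R)‖)

theorem one_le_gauge (a : Rˣ) : 1 ≤ a.gauge := le_max_left _ _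

theorem gauge_pos (a : Rˣ) : 0 < a.gauge := one_pos.trans_le a.one_le_gauge

theorem norm_le_gauge (a : Rˣ) : ‖(a : R)‖ ≤ a.gauge :=
  (le_max_left _ _).trans (le_max_right _ _)

theorem gauge_inv (a : Rˣ) : a⁻¹.gauge = a.gauge := by
  simp [gauge, max_comm]

theorem gauge_le_iff {a : Rˣ} {c : ℝ} (hc : 1 ≤ c) :
    a.gauge ≤ c ↔ ‖(a : R)‖ ≤ c ∧ ‖((a⁻¹ : Rˣ) : R)‖ ≤ c := by
  simp [gauge, hc]

theorem gauge_mul_le (a b : Rˣ) : (a * b).gauge ≤ a.gauge * b.gauge := by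
  have h (x y : Rˣ) : ‖((x * y : Rˣ) : R)‖ ≤ x.gauge * y.gauge := by
    rw [Units.val_mul]
    exact (norm_mul_le _ _).trans
      (mul_le_mul x.norm_le_gauge y.norm_le_gauge (norm_nonneg _) x.gauge_pos.le)
  refine (gauge_le_iff (one_le_mul_of_one_le_of_one_le a.one_le_gauge b.one_le_gauge)).mpr
    ⟨h a b, ?_⟩
  rw [mul_inv_rev, mul_comm a.gauge, ← gauge_inv a, ← gauge_inv b]
  exact h _ _

theorem continuous_gauge : Continuous (gauge : Rˣ → ℝ) :=
  continuous_const.max (Units.continuous_val.norm.max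
    (Units.continuous_val.comp continuous_inv).norm)

/-- The map `a ↦ (a, a⁻¹)` is a closed embedding, and a gauge bound confines both coordinates to
closed balls, which are compact. -/
theorem isCompact_gauge_le [ProperSpace R] (c : ℝ) : IsCompact {a : Rˣ | a.gauge ≤ c} := by
  have hK : IsCompact (Metric.closedBall (0 : R) c ×ˢ
      (MulOpposite.opHomeomorph '' Metric.closedBall (0 : R) c)) :=
    (isCompact_closedBall _ _).prod ((isCompact_closedBall _ _).image
      MulOpposite.opHomeomorph.continuous)
  refine (Units.isClosedEmbedding_embedProduct.isCompact_preimage hK).of_isClosed_subset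
    (isClosed_le continuous_gauge continuous_const) fun a ha => ?_
  have ha : a.gauge ≤ c := ha
  refine ⟨?_, ((a⁻¹ : Rˣ) : R), ?_, rfl⟩
  · simpa using a.norm_le_gauge.trans ha
  · have := a⁻¹.norm_le_gauge.trans (a.gauge_inv.trans_le ha)
    simpa using this

/-- The unit group of a proper normed ring has a net such that balls of a given size contain
a bounded number of points of the net. -/
theorem exists_net [ProperSpace R] (K : ℝ) :
    ∃ (π : Rˣ → Rˣ) (c : ℝ) (M : ℕ), (∀ x, (x⁻¹ * π x).gauge ≤ c) ∧
      ∀ x, ∃ s : Finset Rˣ, s.card ≤ M ∧ ∀ y, (x⁻¹ * y).gauge ≤ K → π y ∈ s := by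
  classical
  -- Any `c` above the gauge of `1` would do. The strict inequality rules out `x ∈ Λ` below and
  -- yields the neighbourhood `W`; the norm of `1` is not assumed to be `1`.
  set c : ℝ := ‖(1 : R)‖ + 2
  have h1 : (1 : Rˣ).gauge < c := by
    have := norm_nonneg (1 : R)
    simp only [gauge, c, inv_one, val_one, max_lt_iff]
    exact ⟨by linarith, by linarith, by linarith⟩
  -- A maximal `c`-separated set is a net: a point far from all of it could be added.
  obtain ⟨Λ, hΛ⟩ := zorn_subset {s : Set Rˣ | s.Pairwise fun a b => c ≤ (a⁻¹ * b).gauge}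
    fun 𝒞 h𝒞 hchain => ⟨⋃₀ 𝒞,
      (Set.pairwise_sUnion hchain.directedOn).mpr fun s hs => h𝒞 hs, fun s => Set.subset_sUnion_of_mem⟩
  have hsep : Λ.Pairwise fun a b => c ≤ (a⁻¹ * b).gauge := hΛ.prop
  have hex : ∀ x : Rˣ, ∃ l ∈ Λ, (x⁻¹ * l).gauge < c := by
    intro x
    by_contra! hx
    have hxΛ : x ∈ Λ := by
      refine hΛ.le_of_ge (y := insert x Λ) ?_ (Set.subset_insert _ _) (Set.mem_insert _ _)
      refine hsep.insert fun l hl _ => ⟨hx l hl, ?_⟩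
      rw [← gauge_inv]
      simpa using hx l hl
    have := hx x hxΛ
    rw [inv_mul_cancel] at this
    linarith
  choose π hπΛ hπ using hex
  obtain ⟨W, hW, hWc⟩ : ∃ W ∈ nhds (1 : Rˣ), ∀ a ∈ W, ∀ b ∈ W, (a⁻¹ * b).gauge < c := by
    have hcont : Continuous fun p : Rˣ × Rˣ => (p.1⁻¹ * p.2).gauge :=
      continuous_gauge.comp (continuous_fst.inv.mul continuous_snd)
    have : {p : Rˣ × Rˣ | (p.1⁻¹ * p.2).gauge < c} ∈ nhds ((1 : Rˣ), (1 : Rˣ)) :=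
      (isOpen_lt hcont continuous_const).mem_nhds (by simpa using h1)
    rw [nhds_prod_eq, Filter.mem_prod_same_iff] at this
    obtain ⟨W, hW, hsub⟩ := this
    exact ⟨W, hW, fun a ha b hb => hsub (Set.mk_mem_prod ha hb)⟩
  -- Two points of `x⁻¹Λ` in one translate `zW` would be closer than `c`, so each translate holds at
  -- most one. The number of translates does not depend on `x`.
  obtain ⟨t, -, ht⟩ := (isCompact_gauge_le (R := R) (K * c)).elim_nhds_subcover
    (fun z => (fun a => z⁻¹ * a) ⁻¹' W)
    fun z _ => (continuous_const_mul z⁻¹).continuousAt.preimage_mem_nhds (by simpa using hW)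
  refine ⟨π, c, t.card, fun x => (hπ x).le, fun x => ?_⟩
  let P : Rˣ → Rˣ → Prop := fun z l => l ∈ Λ ∧ z⁻¹ * (x⁻¹ * l) ∈ W
  refine ⟨t.image fun z => if h : ∃ l, P z l then h.choose else 1, Finset.card_image_le,
    fun y hy => ?_⟩
  have hmem : (x⁻¹ * π y).gauge ≤ K * c := by
    have := gauge_mul_le (x⁻¹ * y) (y⁻¹ * π y)
    rw [mul_assoc, _root_.mul_inv_cancel_left] at this
    exact this.trans (mul_le_mul hy (hπ y).le (gauge_pos _).le ((gauge_pos _).le.trans hy))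
  obtain ⟨z, hz, hzW⟩ := Set.mem_iUnion₂.mp (ht hmem)
  have hP : P z (π y) := ⟨hπΛ y, hzW⟩
  have hex : ∃ l, P z l := ⟨_, hP⟩
  refine Finset.mem_image.mpr ⟨z, hz, ?_⟩
  rw [dif_pos hex]
  by_contra hne
  have h2 := hsep hex.choose_spec.1 hP.1 hne
  have h3 := hWc _ hex.choose_spec.2 _ hP.2
  rw [show (z⁻¹ * (x⁻¹ * hex.choose))⁻¹ * (z⁻¹ * (x⁻¹ * π y)) = hex.choose⁻¹ * π y by group] at h3
  linarith

end Units

/-! ### Triangular matrices, the operator norm and the `RQ` decomposition. -/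

namespace Matrix

section Triangular

variable {ι : Type*} [Fintype ι] [LinearOrder ι] {R : Type*}

theorem IsUpperTriangular.mul_apply_diag [Semiring R] {A B : Matrix ι ι R}
    (hA : A.IsUpperTriangular) (hB : B.IsUpperTriangular) (i : ι) :
    (A * B) i i = A i i * B i i := by
  rw [mul_apply]
  refine Finset.sum_eq_single i (fun j _ hj => ?_) (by simp)
  rcases lt_or_gt_of_ne hj with h | h
  · rw [hA h, zero_mul]
  · rw [hB h, mul_zero]

theorem IsUpperTriangular.val_inv [CommRing R] {a : (Matrix ι ι R)ˣ}
    (h : (a : Matrix ι ι R).IsUpperTriangular) :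
    ((a⁻¹ : (Matrix ι ι R)ˣ) : Matrix ι ι R).IsUpperTriangular := by
  let := a.invertible
  rw [coe_units_inv]
  exact blockTriangular_inv_of_blockTriangular h

theorem IsUpperTriangular.apply_diag_ne_zero [CommRing R] [Nontrivial R] {a : (Matrix ι ι R)ˣ}
    (h : (a : Matrix ι ι R).IsUpperTriangular) (i : ι) : (a : Matrix ι ι R) i i ≠ 0 := by
  intro h0
  have := h.mul_apply_diag h.val_inv i
  rw [Units.mul_inv, h0, zero_mul, one_apply_eq] at this
  exact one_ne_zero this

/-- The diagonal matrices with invertible entries, as units of the matrix ring. -/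
def diagonalUnits (ι R : Type*) [Fintype ι] [DecidableEq ι] [Semiring R] :
    (ι → Rˣ) →* (Matrix ι ι R)ˣ :=
  (Units.map (diagonalRingHom ι R : (ι → R) →* Matrix ι ι R)).comp
    (MulEquiv.piUnits (M := fun _ : ι => R)).symm.toMonoidHom

theorem coe_diagonalUnits [Semiring R] (d : ι → Rˣ) :
    (diagonalUnits ι R d : Matrix ι ι R) = diagonal fun i => (d i : R) := rfl

end Triangular

open scoped Matrix.Norms.L2Operator

variable {n : ℕ}

theorem norm_apply_le_l2_opNorm (A : Matrix (Fin n) (Fin n) ℂ) (i j : Fin n) : ‖A i j‖ ≤ ‖A‖ := by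
  have h := A.l2_opNorm_mulVec (EuclideanSpace.single j 1)
  rw [PiLp.norm_single, norm_one, mul_one] at h
  refine le_trans ?_ ((PiLp.norm_apply_le _ i).trans h)
  simp

theorem norm_trace_le (A : Matrix (Fin n) (Fin n) ℂ) : ‖A.trace‖ ≤ n * ‖A‖ := by
  calc ‖A.trace‖ ≤ ∑ i, ‖A i i‖ := norm_sum_le _ _
    _ ≤ ∑ _i : Fin n, ‖A‖ := Finset.sum_le_sum fun i _ => A.norm_apply_le_l2_opNorm i i
    _ = n * ‖A‖ := by simp

/-- The bound depends on `n` only; this is what keeps the multiplicity of the partitions of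
`GL_n(ℂ)` independent of their scale. -/
theorem exists_l2_opNorm_le_of_norm_apply_le_one (n : ℕ) :
    ∃ K : ℝ, ∀ A : Matrix (Fin n) (Fin n) ℂ, (∀ i j, ‖A i j‖ ≤ 1) → ‖A‖ ≤ K := by
  refine ⟨∑ i, ∑ j, ‖(single i j 1 : Matrix (Fin n) (Fin n) ℂ)‖, fun A hA => ?_⟩
  rw [matrix_eq_sum_single A]
  refine (norm_sum_le _ _).trans (Finset.sum_le_sum fun i _ => (norm_sum_le _ _).trans
    (Finset.sum_le_sum fun j _ => ?_))
  have : single i j (A i j) = A i j • (single i j 1 : Matrix (Fin n) (Fin n) ℂ) := by simp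
  rw [this]
  exact (norm_smul_le _ _).trans (mul_le_of_le_one_left (norm_nonneg _) (hA i j))

theorem gauge_diagonalUnits_le {d : Fin n → ℂˣ} {c : ℝ} (hc : 1 ≤ c)
    (h : ∀ i, ‖(d i : ℂ)‖ ≤ c) (h' : ∀ i, ‖(d i : ℂ)‖⁻¹ ≤ c) :
    (diagonalUnits (Fin n) ℂ d).gauge ≤ c := by
  have hc0 : 0 ≤ c := zero_le_one.trans hc
  rw [Units.gauge_le_iff hc, ← map_inv, coe_diagonalUnits, coe_diagonalUnits, l2_opNorm_diagonal,
    l2_opNorm_diagonal, pi_norm_le_iff_of_nonneg hc0, pi_norm_le_iff_of_nonneg hc0]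
  exact ⟨h, fun i => by simpa using h' i⟩

/-- The operator norm is invariant under unitary factors on both sides, so the pseudo-distance of
two matrices is that of their triangular factors. -/
theorem gauge_eq_of_mem_unitary {u v : (Matrix (Fin n) (Fin n) ℂ)ˣ}
    (hu : (u : Matrix (Fin n) (Fin n) ℂ) ∈ unitary (Matrix (Fin n) (Fin n) ℂ))
    (hv : (v : Matrix (Fin n) (Fin n) ℂ) ∈ unitary (Matrix (Fin n) (Fin n) ℂ))
    (a : (Matrix (Fin n) (Fin n) ℂ)ˣ) : (u⁻¹ * a * v).gauge = a.gauge := by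
  have hinv {w : (Matrix (Fin n) (Fin n) ℂ)ˣ}
      (hw : (w : Matrix (Fin n) (Fin n) ℂ) ∈ unitary (Matrix (Fin n) (Fin n) ℂ)) :
      ((w⁻¹ : (Matrix (Fin n) (Fin n) ℂ)ˣ) : Matrix (Fin n) (Fin n) ℂ) ∈
        unitary (Matrix (Fin n) (Fin n) ℂ) := by
    have : ((w⁻¹ : (Matrix (Fin n) (Fin n) ℂ)ˣ) : Matrix (Fin n) (Fin n) ℂ) =
        star (w : Matrix (Fin n) (Fin n) ℂ) :=
      Units.inv_eq_of_mul_eq_one_right (Unitary.mul_star_self_of_mem hw)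
    rw [this]
    exact Unitary.star_mem hw
  simp only [Units.gauge, _root_.mul_inv_rev, inv_inv, Units.val_mul, ← mul_assoc]
  rw [CStarRing.norm_mul_mem_unitary _ hv, CStarRing.norm_mem_unitary_mul _ (hinv hu),
    CStarRing.norm_mul_mem_unitary _ hu, CStarRing.norm_mem_unitary_mul _ (hinv hv)]

/-- The `QR` decomposition, in the order `RQ`. -/
theorem exists_isUpperTriangular_mul_unitary (g : (Matrix (Fin n) (Fin n) ℂ)ˣ) :
    ∃ b u : (Matrix (Fin n) (Fin n) ℂ)ˣ, g = b * u ∧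
      (b : Matrix (Fin n) (Fin n) ℂ).IsUpperTriangular ∧
      (u : Matrix (Fin n) (Fin n) ℂ) ∈ unitary (Matrix (Fin n) (Fin n) ℂ) := by
  -- Gram–Schmidt on the columns of `g⁻¹` gives `g⁻¹ = V R`. Inverting puts the unitary factor on
  -- the right, where it does not affect the left-invariant pseudo-distance.
  let f : Fin n → EuclideanSpace ℂ (Fin n) :=
    fun j => WithLp.toLp 2 fun i => ((g⁻¹ : (Matrix (Fin n) (Fin n) ℂ)ˣ) : Matrix _ _ ℂ) i j
  let e := InnerProductSpace.gramSchmidtOrthonormalBasis (𝕜 := ℂ) (by simp) f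
  let v := (EuclideanSpace.basisFun (Fin n) ℂ).toBasis.toMatrix e
  have hv : v ∈ unitary (Matrix (Fin n) (Fin n) ℂ) :=
    OrthonormalBasis.toMatrix_orthonormalBasis_mem_unitary _ _
  let V : (Matrix (Fin n) (Fin n) ℂ)ˣ := Unitary.toUnits ⟨v, hv⟩
  have hR : (e.toBasis.toMatrix f).IsUpperTriangular :=
    InnerProductSpace.gramSchmidtOrthonormalBasis_inv_isUpperTriangular _ f
  have hg : v * e.toBasis.toMatrix f =
      ((g⁻¹ : (Matrix (Fin n) (Fin n) ℂ)ˣ) : Matrix _ _ ℂ) := by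
    have := (EuclideanSpace.basisFun (Fin n) ℂ).toBasis.toMatrix_mul_toMatrix e.toBasis f
    rw [OrthonormalBasis.coe_toBasis] at this
    rw [this]
    ext i j
    simp [Module.Basis.toMatrix_apply, f]
  have hR' : ((V⁻¹ * g⁻¹ : (Matrix (Fin n) (Fin n) ℂ)ˣ) : Matrix (Fin n) (Fin n) ℂ) =
      e.toBasis.toMatrix f := by
    rw [Units.val_mul, ← hg, ← mul_assoc]
    exact (congrArg (· * _) V.inv_mul).trans (one_mul _)
  rw [← hR'] at hR
  refine ⟨(V⁻¹ * g⁻¹)⁻¹, V⁻¹, by group, hR.val_inv, ?_⟩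
  exact Unitary.star_mem hv

end Matrix

/-! ### Finite asymptotic dimension of `GL_n(ℂ)`. -/

namespace Matrix

open scoped Matrix.Norms.L2Operator

variable {n : ℕ}

/-- If `r c s⁻¹` is upper unitriangular with entries bounded by `E`, then its conjugate by the
diagonal matrix with entries of absolute value `E ^ i` has entries bounded by `1`. -/
theorem norm_diagonal_conj_apply_le_one {c : Matrix (Fin n) (Fin n) ℂ} (hc : c.IsUpperTriangular)
    {r s : Fin n → ℂˣ} {E : ℝ} (hE : 1 ≤ E)
    (hdiag : ∀ i, (r i : ℂ) * c i i = s i)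
    (hbound : ∀ i j, ‖(r i : ℂ)‖ * ‖c i j‖ * ‖(s j : ℂ)‖⁻¹ ≤ E)
    {e : Fin n → ℂˣ} (he : ∀ i, ‖(e i : ℂ)‖ = E ^ (i : ℕ)) (i j : Fin n) :
    ‖(diagonal (fun k => (e k : ℂ) * r k) * c *
      diagonal (fun k => ((s k : ℂ)⁻¹ * (e k : ℂ)⁻¹))) i j‖ ≤ 1 := by
  have hE0 : 0 < E := one_pos.trans_le hE
  rw [mul_diagonal, diagonal_mul]
  rcases lt_trichotomy j i with h | rfl | h
  · rw [hc h]; simp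
  · have : (e j : ℂ) * r j * c j j * ((s j : ℂ)⁻¹ * (e j : ℂ)⁻¹) = 1 := by
      rw [mul_assoc (e j : ℂ), hdiag]
      field_simp
    rw [this, norm_one]
  · simp only [norm_mul, norm_inv, he]
    calc E ^ (i : ℕ) * ‖(r i : ℂ)‖ * ‖c i j‖ * (‖(s j : ℂ)‖⁻¹ * (E ^ (j : ℕ))⁻¹)
        = (‖(r i : ℂ)‖ * ‖c i j‖ * ‖(s j : ℂ)‖⁻¹) * (E ^ (i : ℕ) * (E ^ (j : ℕ))⁻¹) := by ring
      _ ≤ E * (E ^ (i : ℕ) * (E ^ (j : ℕ))⁻¹) := by gcongr; exact hbound i j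
      _ = E ^ (i + 1 : ℕ) * (E ^ (j : ℕ))⁻¹ := by ring
      -- Above the diagonal `i + 1 ≤ j`, so the power of `E` gained by conjugation absorbs the bound
      -- `E`.
      _ ≤ E ^ (j : ℕ) * (E ^ (j : ℕ))⁻¹ := by gcongr ?_ * _; exact pow_le_pow_right₀ hE h
      _ = 1 := mul_inv_cancel₀ (by positivity)

/-- The group `GL_n(ℂ)`, with the left-invariant pseudo-distance `log (gauge (x⁻¹ y))`, has finite
asymptotic dimension. -/
theorem hasBoundedMultiplicityPartitions_log_gauge (n : ℕ) :
    HasBoundedMultiplicityPartitions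
      fun x y : (Matrix (Fin n) (Fin n) ℂ)ˣ => Real.log (x⁻¹ * y).gauge := by
  classical
  have : ProperSpace (Matrix (Fin n) (Fin n) ℂ) := FiniteDimensional.proper ℂ _
  obtain ⟨K, hK⟩ := exists_l2_opNorm_le_of_norm_apply_le_one n
  -- The net and `M` are fixed before the scale `d`: the contraction `w` below brings nearby points
  -- of one box within `max 1 K`, whatever `d` is.
  obtain ⟨π, c, M, hπ, hM⟩ := Units.exists_net (R := Matrix (Fin n) (Fin n) ℂ) (max 1 K)
  choose b u hbu hb hu using exists_isUpperTriangular_mul_unitary (n := n)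
  have hgauge : ∀ x y, ((b x)⁻¹ * b y).gauge = (x⁻¹ * y).gauge := fun x y => by
    rw [← gauge_eq_of_mem_unitary (hu x) (hu y)]
    conv_rhs => rw [hbu x, hbu y]
    congr 1
    group
  have htri : ∀ x y, (((b x)⁻¹ * b y : (Matrix (Fin n) (Fin n) ℂ)ˣ) :
      Matrix (Fin n) (Fin n) ℂ).IsUpperTriangular := fun x y => (hb x).val_inv.mul (hb y)
  let β : (Matrix (Fin n) (Fin n) ℂ)ˣ → Fin n → ℂˣ :=
    fun x i => Units.mk0 _ ((hb x).apply_diag_ne_zero i)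
  have hβ : ∀ x y i, (β x i : ℂ) * ((b x)⁻¹ * b y : (Matrix (Fin n) (Fin n) ℂ)ˣ).val i i =
      β y i := fun x y i => by
    have := (hb x).mul_apply_diag (htri x y) i
    rw [← Units.val_mul, mul_inv_cancel_left] at this
    exact this.symm
  -- A ball of radius `d` meets at most `3 ^ n` boxes of the grid `q`, and at most `M` pieces in
  -- each.
  refine ⟨3 ^ n * M, fun d => ?_⟩
  set R : ℝ := max d 1
  have hR : 0 < R := one_pos.trans_le (le_max_right _ _)
  have hclose : ∀ x y : (Matrix (Fin n) (Fin n) ℂ)ˣ, Real.log (x⁻¹ * y).gauge ≤ d →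
      (x⁻¹ * y).gauge ≤ Real.exp R := fun x y h =>
    (Real.log_le_iff_le_exp (Units.gauge_pos _)).mp (h.trans (le_max_left _ _))
  let q : (Matrix (Fin n) (Fin n) ℂ)ˣ → Fin n → ℤ := fun x i => ⌊Real.log ‖(β x i : ℂ)‖ / R⌋
  -- The diagonal `β x` is rounded in absolute value only. The quotient `β x / t (q x)` keeps the
  -- argument of `β x`, so it normalises diagonal entries to exactly `1`, and its absolute values
  -- lie in `[1, exp R]`.
  let t : (Fin n → ℤ) → Fin n → ℂˣ := fun k i =>
    Units.mk0 (Real.exp (R * k i) : ℂ) (by exact_mod_cast (Real.exp_pos _).ne')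
  have ht : ∀ k i, ‖(t k i : ℂ)‖ = Real.exp (R * k i) := fun k i => by
    simp only [t, Units.val_mk0, Complex.norm_real, Real.norm_eq_abs, Real.abs_exp]
  have hr : ∀ x i, 1 ≤ ‖((β x / t (q x)) i : ℂˣ).val‖ ∧
      ‖((β x / t (q x)) i : ℂˣ).val‖ ≤ Real.exp R := fun x i => by
    have hpos : 0 < ‖(β x i : ℂ)‖ := norm_pos_iff.mpr (β x i).ne_zero
    have h1 : (q x i : ℝ) ≤ Real.log ‖(β x i : ℂ)‖ / R := Int.floor_le _
    have h2 : Real.log ‖(β x i : ℂ)‖ / R < q x i + 1 := Int.lt_floor_add_one _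
    rw [le_div_iff₀ hR] at h1
    rw [div_lt_iff₀ hR] at h2
    rw [Pi.div_apply, Units.val_div_eq_div_val, norm_div, ht, one_le_div (Real.exp_pos _),
      div_le_iff₀ (Real.exp_pos _), ← Real.exp_add, ← Real.le_log_iff_exp_le hpos,
      ← Real.log_le_iff_le_exp hpos]
    constructor <;> linarith
  -- One factor `exp R` comes from `β x / t (q x)`, and two from the gauge between two points of the
  -- same ball.
  set E : ℝ := Real.exp (3 * R)
  have hE : 1 ≤ E := Real.one_le_exp (by positivity)
  have hE0 : 0 < E := one_pos.trans_le hE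
  let e : Fin n → ℂˣ := fun i => Units.mk0 ((E : ℂ) ^ (i : ℕ)) (by
    have : (E : ℂ) ≠ 0 := by exact_mod_cast hE0.ne'
    positivity)
  have he : ∀ i, ‖(e i : ℂ)‖ = E ^ (i : ℕ) := fun i => by
    simp only [e, Units.val_mk0, norm_pow, Complex.norm_real, Real.norm_eq_abs, abs_of_pos hE0]
  -- Right multiplication by `(δ x)⁻¹` moves `b x` by a bounded amount depending on `d`, so `w`
  -- distorts distances boundedly (`hfar`). Within one box it shrinks the entries above the diagonal
  -- by powers of `E` and makes the diagonal `1` (`hnorm`).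
  let δ : (Matrix (Fin n) (Fin n) ℂ)ˣ → (Matrix (Fin n) (Fin n) ℂ)ˣ :=
    fun x => diagonalUnits (Fin n) ℂ (e * (β x / t (q x)))
  let w : (Matrix (Fin n) (Fin n) ℂ)ˣ → (Matrix (Fin n) (Fin n) ℂ)ˣ := fun x => b x * (δ x)⁻¹
  set P : ℝ := E ^ n * Real.exp R
  have hP : 1 ≤ P := one_le_mul_of_one_le_of_one_le (one_le_pow₀ hE) (Real.one_le_exp hR.le)
  have hδ : ∀ x, (δ x).gauge ≤ P := fun x => by
    have h1 : ∀ i, 1 ≤ ‖((e * (β x / t (q x))) i).val‖ := fun i => by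
      rw [Pi.mul_apply, Units.val_mul, norm_mul, he]
      exact one_le_mul_of_one_le_of_one_le (one_le_pow₀ hE) (hr x i).1
    refine gauge_diagonalUnits_le hP (fun i => ?_) fun i => (inv_le_one_of_one_le₀ (h1 i)).trans hP
    rw [Pi.mul_apply, Units.val_mul, norm_mul, he]
    exact mul_le_mul (pow_le_pow_right₀ hE i.2.le) (hr x i).2 (norm_nonneg _) (by positivity)
  have hw : ∀ x y, (w x)⁻¹ * w y = δ x * ((b x)⁻¹ * b y) * (δ y)⁻¹ := fun x y => by
    simp only [w]
    group
  have hfar : ∀ x y, (x⁻¹ * y).gauge ≤ P * ((w x)⁻¹ * w y).gauge * P := fun x y => by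
    rw [← hgauge, show (b x)⁻¹ * b y = (δ x)⁻¹ * ((w x)⁻¹ * w y) * δ y by rw [hw]; group]
    refine (Units.gauge_mul_le _ _).trans (mul_le_mul ((Units.gauge_mul_le _ _).trans ?_) (hδ y)
      (Units.gauge_pos _).le (by positivity [Units.gauge_pos ((w x)⁻¹ * w y)]))
    rw [Units.gauge_inv]
    exact mul_le_mul_of_nonneg_right (hδ x) (Units.gauge_pos _).le
  have hnorm : ∀ x y, q x = q y → (x⁻¹ * y).gauge ≤ Real.exp R * Real.exp R →
      ‖((w x)⁻¹ * w y).val‖ ≤ K := fun x y hq hxy => by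
    refine hK _ fun i j => ?_
    have key := norm_diagonal_conj_apply_le_one (htri x y) (r := β x / t (q x))
      (s := β y / t (q y)) hE (fun i => ?_) (fun i j => ?_) he i j
    · rw [hw, Units.val_mul, Units.val_mul, ← map_inv, coe_diagonalUnits, coe_diagonalUnits]
      simpa only [Pi.inv_apply, Pi.mul_apply, _root_.mul_inv_rev, Units.val_mul,
        Units.val_inv_eq_inv_val] using key
    · rw [← hq, Pi.div_apply, Pi.div_apply, Units.val_div_eq_div_val, Units.val_div_eq_div_val,
        ← hβ x y i, div_mul_eq_mul_div]
    · have h1 := (norm_apply_le_l2_opNorm _ i j).trans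
        (((b x)⁻¹ * b y).norm_le_gauge.trans ((hgauge x y).trans_le hxy))
      calc _ ≤ Real.exp R * (Real.exp R * Real.exp R) * 1 := by
            gcongr
            · exact (hr x i).2
            · exact inv_le_one_of_one_le₀ (hr y j).1
        _ = E := by
            simp only [E, mul_one, ← Real.exp_add]
            ring_nf
  have hnear : ∀ x y, q x = q y → (x⁻¹ * y).gauge ≤ Real.exp R * Real.exp R →
      ((w x)⁻¹ * w y).gauge ≤ max 1 K := fun x y hq hxy => by
    refine (Units.gauge_le_iff (le_max_left _ _)).mpr
      ⟨(hnorm x y hq hxy).trans (le_max_right _ _), ?_⟩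
    rw [_root_.mul_inv_rev, inv_inv]
    refine (hnorm y x hq.symm ?_).trans (le_max_right _ _)
    rwa [← Units.gauge_inv, _root_.mul_inv_rev, inv_inv]
  have hstep : ∀ x y, (x⁻¹ * y).gauge ≤ Real.exp R → ∀ i, q y i ≤ q x i + 1 := fun x y hxy i => by
    have hx : 0 < ‖(β x i : ℂ)‖ := norm_pos_iff.mpr (β x i).ne_zero
    have hy : 0 < ‖(β y i : ℂ)‖ := norm_pos_iff.mpr (β y i).ne_zero
    have h1 := (norm_apply_le_l2_opNorm _ i i).trans
      (((b x)⁻¹ * b y).norm_le_gauge.trans ((hgauge x y).trans_le hxy))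
    have h2 : ‖(β y i : ℂ)‖ ≤ ‖(β x i : ℂ)‖ * Real.exp R := by
      rw [← hβ x y i, norm_mul]
      gcongr
    have h3 : Real.log ‖(β y i : ℂ)‖ ≤ Real.log ‖(β x i : ℂ)‖ + R := by
      have := Real.log_le_log hy h2
      rwa [Real.log_mul hx.ne' (Real.exp_pos _).ne', Real.log_exp] at this
    calc q y i ≤ ⌊Real.log ‖(β x i : ℂ)‖ / R + 1⌋ := by
          refine Int.floor_le_floor ?_
          rw [div_add_one hR.ne']
          gcongr
      _ = q x i + 1 := Int.floor_add_one _
  refine ⟨(Fin n → ℤ) × (Matrix (Fin n) (Fin n) ℂ)ˣ, fun x => (q x, π (w x)),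
    ⟨Real.log (P * (c * c) * P), fun x y hxy => ?_⟩, fun x => ?_⟩
  · refine Real.log_le_log (Units.gauge_pos _) ((hfar x y).trans ?_)
    have h1 : ((w x)⁻¹ * w y).gauge ≤ c * c := by
      rw [show (w x)⁻¹ * w y = ((w x)⁻¹ * π (w x)) * ((w y)⁻¹ * π (w x))⁻¹ by group]
      refine (Units.gauge_mul_le _ _).trans ?_
      rw [Units.gauge_inv]
      have hxy : π (w x) = π (w y) := congrArg Prod.snd hxy
      exact mul_le_mul (hπ _) (hxy ▸ hπ _) (Units.gauge_pos _).le
        ((Units.gauge_pos _).le.trans (hπ (w x)))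
    gcongr
  · choose F hF hF' using hM
    let near : (Fin n → ℤ) → (Matrix (Fin n) (Fin n) ℂ)ˣ → Prop :=
      fun k y => q y = k ∧ (x⁻¹ * y).gauge ≤ Real.exp R
    -- In each neighbouring box that meets the ball, one point is chosen; `w` sends every other such
    -- point of that box within `max 1 K` of its image, so the net points near that image suffice.
    refine ⟨(Fintype.piFinset fun i => Finset.Icc (q x i - 1) (q x i + 1)).biUnion fun k =>
      (if h : ∃ y, near k y then F (w h.choose) else ∅).image (Prod.mk k), ?_, fun y hy => ?_⟩
    · refine (Finset.card_biUnion_le_card_mul _ _ M fun k _ => Finset.card_image_le.trans ?_).trans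
        (Nat.mul_le_mul_right _ ?_)
      · split_ifs
        exacts [hF _, Nat.zero_le _]
      · rw [Fintype.card_piFinset]
        simp [show ∀ a : ℤ, a + 1 + 1 - (a - 1) = 3 by intro a; ring]
    · have hy := hclose x y hy
      have hy' : (y⁻¹ * x).gauge ≤ Real.exp R := by
        rwa [← Units.gauge_inv, _root_.mul_inv_rev, inv_inv]
      have hex : ∃ z, near (q y) z := ⟨y, rfl, hy⟩
      refine Finset.mem_biUnion.mpr ⟨q y, Fintype.mem_piFinset.mpr fun i => Finset.mem_Icc.mpr
        ⟨by linarith [hstep y x hy' i], hstep x y hy i⟩, Finset.mem_image_of_mem _ ?_⟩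
      rw [dif_pos hex]
      obtain ⟨hz, hz'⟩ := hex.choose_spec
      refine hF' _ _ (hnear _ _ hz ?_)
      rw [show hex.choose⁻¹ * y = (x⁻¹ * hex.choose)⁻¹ * (x⁻¹ * y) by group]
      refine (Units.gauge_mul_le _ _).trans ?_
      rw [Units.gauge_inv]
      exact mul_le_mul hz' hy (Units.gauge_pos _).le (Real.exp_pos _).le

end Matrix

open Matrix

/-! ### Irreducibility and separation by traces. -/

/-- **Burnside's theorem**: the operators of an irreducible finite-dimensional representation over
an algebraically closed field span the algebra of all endomorphisms. -/
theorem Representation.IsIrreducible.span_range_eq_top {k H V : Type*} [Field k] [IsAlgClosed k]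
    [Group H] [AddCommGroup V] [Module k V] [FiniteDimensional k V] {ρ : Representation k H V}
    (h : ρ.IsIrreducible) : Submodule.span k (Set.range ρ) = ⊤ := by
  refine Submodule.eq_top_iff'.mpr fun f => ?_
  let A := MonoidAlgebra k H
  let b := Module.finBasis k V
  classical
  -- By Schur's lemma the endomorphisms of the simple module are scalars, so `f` commutes with them
  -- and the density theorem realises `f` on a basis by an element of the group algebra.
  let F : Module.End (Module.End A ρ.asModule) ρ.asModule :=
    { toFun := fun x => ρ.asModuleEquiv.symm (f (ρ.asModuleEquiv x))
      map_add' := by simp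
      map_smul' := fun e x => by
        obtain ⟨c, rfl⟩ :=
          (IsSimpleModule.algebraMap_end_bijective_of_isAlgClosed (A := A) (V := ρ.asModule) k).2 e
        simp }
  obtain ⟨r, hr⟩ := jacobson_density F (Finset.univ.image fun i => ρ.asModuleEquiv.symm (b i))
  have hf : f = ρ.asAlgebraHom r := by
    refine b.ext fun i => ?_
    have := hr _ (Finset.mem_image_of_mem _ (Finset.mem_univ i))
    have := congrArg ρ.asModuleEquiv this
    rw [ρ.asModuleEquiv_map_smul] at this
    simpa [F] using this
  rw [hf]
  clear hf hr
  induction r using MonoidAlgebra.induction_on with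
  | of g =>
    rw [ρ.asAlgebraHom_of]
    exact Submodule.subset_span ⟨g, rfl⟩
  | add x y hx hy =>
    rw [map_add]
    exact add_mem hx hy
  | smul c x hx =>
    rw [map_smul]
    exact Submodule.smul_mem _ _ hx

variable {n : ℕ}

/-- Matrices are determined by the traces of their products with finitely many elements of a given
irreducible group. -/
theorem ActsIrreducibly.exists_finite_trace_separating
    {Γ : Subgroup (SpecialLinearGroup (Fin n) ℂ)} (h : ActsIrreducibly Γ) :
    ∃ (k : ℕ) (γ : Fin k → SpecialLinearGroup (Fin n) ℂ), (∀ i, γ i ∈ Γ) ∧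
      ∀ X Y : Matrix (Fin n) (Fin n) ℂ,
        (∀ i, (X * (γ i : Matrix _ _ ℂ)).trace = (Y * (γ i : Matrix _ _ ℂ)).trace) → X = Y := by
  -- Finitely many group elements already span all matrices, and the trace form is non-degenerate.
  obtain ⟨f, hf, hspan, -⟩ :=
    Submodule.exists_fun_fin_finrank_span_eq ℂ (Set.range (naturalRep Γ))
  choose γ hγ using hf
  refine ⟨_, fun i => γ i, fun i => (γ i).2, fun X Y hXY => ?_⟩
  rw [ext_iff_trace_mul_right]
  intro Z
  have hZ : toLin' Z ∈ Submodule.span ℂ (Set.range f) := by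
    rw [hspan, Representation.IsIrreducible.span_range_eq_top h]
    trivial
  have key : ∀ T ∈ Submodule.span ℂ (Set.range f),
      (X * LinearMap.toMatrix' T).trace = (Y * LinearMap.toMatrix' T).trace := by
    intro T hT
    induction hT using Submodule.span_induction with
    | mem T hT =>
      obtain ⟨i, rfl⟩ := hT
      rw [← hγ i]
      simpa [naturalRep] using hXY i
    | zero => simp
    | add S T _ _ hS hT => simp [mul_add, hS, hT]
    | smul c T _ hT => simp [hT]
  simpa using key _ hZ

/-! ### Specialisation to a number field. -/

/-- A finitely generated linear group has its entries in a finitely generated `ℚ`-algebra. -/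
theorem Matrix.SpecialLinearGroup.exists_finiteType_le_range_map
    {G : Subgroup (SpecialLinearGroup (Fin n) ℂ)} (hG : G.FG) :
    ∃ A : Subalgebra ℚ ℂ, Algebra.FiniteType ℚ A ∧
      G ≤ (SpecialLinearGroup.map (n := Fin n) (A.val : A →+* ℂ)).range := by
  obtain ⟨S, rfl⟩ := hG
  let E : Set ℂ := ⋃ g ∈ S, Set.range fun p : Fin n × Fin n => (g : Matrix _ _ ℂ) p.1 p.2
  have hE : E.Finite := S.finite_toSet.biUnion fun g _ => Set.finite_range _
  refine ⟨Algebra.adjoin ℚ E, (Subalgebra.fg_iff_finiteType _).mp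
    ((Subalgebra.fg_def).mpr ⟨E, hE, rfl⟩), (Subgroup.closure_le _).mpr fun g hg => ?_⟩
  let B : Matrix (Fin n) (Fin n) (Algebra.adjoin ℚ E) := of fun i j =>
    ⟨(g : Matrix _ _ ℂ) i j, Algebra.subset_adjoin (Set.mem_biUnion hg ⟨(i, j), rfl⟩)⟩
  have hB : B.map (Algebra.adjoin ℚ E).val = (g : Matrix _ _ ℂ) := rfl
  have hdet : B.det = 1 := by
    refine Subtype.val_injective ?_
    have := (Algebra.adjoin ℚ E).val.map_det B
    rw [AlgHom.mapMatrix_apply, hB, g.det_coe] at this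
    exact this
  exact ⟨⟨B, hdet⟩, Subtype.ext hB⟩

/-- **Zariski's lemma**: a non-zero finitely generated `ℚ`-algebra maps to a number field. -/
theorem exists_ringHom_numberField (A : Type u) [CommRing A] [Nontrivial A] [Algebra ℚ A]
    [Algebra.FiniteType ℚ A] :
    ∃ (F : Type u) (_ : Field F) (_ : NumberField F), Nonempty (A →+* F) := by
  obtain ⟨m, hm⟩ := Ideal.exists_maximal A
  let _ := Ideal.Quotient.field m
  have : Module.Finite ℚ (A ⧸ m) := finite_of_finite_type_of_isJacobsonRing _ _
  have : CharZero (A ⧸ m) := algebraRat.charZero _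
  refine ⟨A ⧸ m, inferInstance, { to_charZero := this, to_finiteDimensional := ?_ },
    ⟨Ideal.Quotient.mk m⟩⟩
  convert ‹Module.Finite ℚ (A ⧸ m)›
  exact Subsingleton.elim _ _

/-- A ring homomorphism from a `ℚ`-subalgebra of a field to a non-zero ring is injective on
algebraic integers. -/
theorem Subalgebra.eq_of_map_eq_of_isIntegral {L : Type*} [Field L] [Algebra ℚ L]
    {A : Subalgebra ℚ L} {F : Type*} [Ring F] [Nontrivial F] (φ : A →+* F) {a b : A}
    (ha : IsIntegral ℤ (a : L)) (hb : IsIntegral ℤ (b : L)) (h : φ a = φ b) : a = b := by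
  by_contra hne
  have hne' : (a - b : L) ≠ 0 := fun h0 => hne (Subtype.ext (sub_eq_zero.mp h0))
  have hint : IsIntegral ℚ (a - b : L) := (ha.sub hb).tower_top
  -- The inverse of an element algebraic over `ℚ` is a polynomial in it over `ℚ`, hence lies in `A`;
  -- so `φ` cannot kill `a - b`.
  let c : A := ⟨(a - b : L)⁻¹, hint.inv_mem (sub_mem a.2 b.2)⟩
  have hc : (a - b) * c = 1 := Subtype.ext (mul_inv_cancel₀ hne')
  have := congrArg φ hc
  rw [map_mul, map_sub, h, sub_self, zero_mul, map_one] at this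
  exact zero_ne_one this

/-- Up to sign the trace is the second-highest coefficient of the characteristic polynomial, except
for `n = 0`, where it vanishes. -/
theorem HasIntegralCharacteristic.isIntegral_trace
    {Γ : Subgroup (SpecialLinearGroup (Fin n) ℂ)} (h : HasIntegralCharacteristic Γ)
    {g : SpecialLinearGroup (Fin n) ℂ} (hg : g ∈ Γ) :
    IsIntegral ℤ (g : Matrix (Fin n) (Fin n) ℂ).trace := by
  rcases isEmpty_or_nonempty (Fin n) with hn | hn
  · simpa using isIntegral_zero
  · rw [trace_eq_neg_charpoly_coeff]
    exact (h g hg _).neg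

/-! ### The length function and the conclusion. -/

open scoped Matrix.Norms.L2Operator in
/-- A finitely generated linear group has finitely many representations that are jointly proper on
all its irreducible subgroups with integral characteristic. -/
theorem exists_representations_finite_gauge_le {G : Subgroup (SpecialLinearGroup (Fin n) ℂ)}
    (hG : G.FG) :
    ∃ (ι : Type) (_ : Fintype ι) (ρ : ι → G →* (Matrix (Fin n) (Fin n) ℂ)ˣ),
      ∀ Γ : Subgroup G, HasIntegralCharacteristic (Γ.map G.subtype) →
        ActsIrreducibly (Γ.map G.subtype) →
        ∀ c : ℝ, {g : G | g ∈ Γ ∧ ∀ i, (ρ i g).gauge ≤ c}.Finite := by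
  obtain ⟨A, hA, hGA⟩ := SpecialLinearGroup.exists_finiteType_le_range_map hG
  obtain ⟨F, _, _, ⟨φ⟩⟩ := exists_ringHom_numberField A
  have hinj : Function.Injective (SpecialLinearGroup.map (n := Fin n) (A.val : A →+* ℂ)) := by
    intro x y hxy
    ext i j
    exact congrArg (fun z : SpecialLinearGroup (Fin n) ℂ => (z : Matrix _ _ ℂ) i j) hxy
  let lift : G →* SpecialLinearGroup (Fin n) A :=
    (MonoidHom.ofInjective hinj).symm.toMonoidHom.comp (Subgroup.inclusion hGA)
  have hlift : ∀ g : G, SpecialLinearGroup.map (A.val : A →+* ℂ) (lift g) = g := fun g =>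
    congrArg Subtype.val ((MonoidHom.ofInjective hinj).apply_symm_apply (Subgroup.inclusion hGA g))
  let ρ : (F →+* ℂ) → G →* (Matrix (Fin n) (Fin n) ℂ)ˣ := fun σ =>
    SpecialLinearGroup.toGL.comp ((SpecialLinearGroup.map (σ.comp φ)).comp lift)
  have hρ : ∀ σ g, (ρ σ g : Matrix (Fin n) (Fin n) ℂ) =
      (lift g : Matrix (Fin n) (Fin n) A).map (σ.comp φ) := fun σ g => rfl
  refine ⟨F →+* ℂ, inferInstance, ρ, fun Γ hint hirr c => ?_⟩
  obtain ⟨k, γ, hγ, hsep⟩ := hirr.exists_finite_trace_separating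
  choose γ' hγ' hγγ using hγ
  let τ : G → Fin k → A := fun g i => (lift (g * γ' i) : Matrix (Fin n) (Fin n) A).trace
  have hτ : ∀ g i, (τ g i : ℂ) = ((g : SpecialLinearGroup (Fin n) ℂ) * γ i).val.trace := by
    intro g i
    have h1 := hlift (g * γ' i)
    have h2 : ((g * γ' i : G) : SpecialLinearGroup (Fin n) ℂ) = g * γ i := by
      rw [← hγγ i]
      rfl
    rw [← h2, ← h1]
    exact AddMonoidHom.map_trace (A.val : A →+ ℂ) _
  have hτint : ∀ g ∈ Γ, ∀ i, IsIntegral ℤ (τ g i : ℂ) := by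
    intro g hg i
    rw [hτ, ← hγγ i]
    exact hint.isIntegral_trace ⟨g * γ' i, mul_mem hg (hγ' i), rfl⟩
  obtain ⟨B, hB⟩ : ∃ B : ℝ, ∀ (i : Fin k) (σ : F →+* ℂ), (ρ σ (γ' i)).gauge ≤ B := by
    obtain ⟨B, hB⟩ := (Set.finite_range fun p : Fin k × (F →+* ℂ) =>
      (ρ p.2 (γ' p.1)).gauge).bddAbove
    exact ⟨B, fun i σ => hB ⟨(i, σ), rfl⟩⟩
  -- An element is encoded by the images in `F` of its traces against the `γ i`. These are integral
  -- with all conjugates at most `n * (c * B)`, as a trace is at most `n` times the norm and the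
  -- gauge is submultiplicative; a number field has finitely many such elements.
  refine Set.Finite.of_finite_image (f := fun g i => φ (τ g i))
    ((Set.Finite.pi' fun _ : Fin k =>
      NumberField.Embeddings.finite_of_norm_le F ℂ (n * (c * B))).subset ?_) ?_
  · rintro _ ⟨g, ⟨hg, hgc⟩, rfl⟩ i
    have hA' : IsIntegral ℤ (τ g i) :=
      (isIntegral_algHom_iff (A.val.restrictScalars ℤ) Subtype.val_injective).mp (hτint g hg i)
    refine ⟨hA'.map φ.toIntAlgHom, fun σ => ?_⟩
    have h1 : σ (φ (τ g i)) = (ρ σ (g * γ' i) : Matrix (Fin n) (Fin n) ℂ).trace := by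
      rw [hρ]
      exact AddMonoidHom.map_trace (σ.comp φ : A →+ ℂ) _
    rw [h1]
    refine (norm_trace_le _).trans (mul_le_mul_of_nonneg_left ?_ n.cast_nonneg)
    rw [map_mul]
    refine ((ρ σ g * ρ σ (γ' i)).norm_le_gauge.trans (Units.gauge_mul_le _ _)).trans ?_
    exact mul_le_mul (hgc σ) (hB i σ) (Units.gauge_pos _).le ((Units.gauge_pos _).le.trans (hgc σ))
  -- The code is injective on `Γ`: equal images under `φ` force equal traces because these are
  -- integral, and the traces determine the matrix.
  · rintro g ⟨hg, -⟩ h ⟨hh, -⟩ hgh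
    refine Subtype.ext (Subtype.ext (hsep _ _ fun i => ?_))
    have := Subalgebra.eq_of_map_eq_of_isIntegral φ (hτint g hg i) (hτint h hh i) (congrFun hgh i)
    have := congrArg (Subtype.val : A → ℂ) this
    rwa [hτ, hτ] at this

open scoped Matrix.Norms.L2Operator in
/-- A finitely generated linear group has a length function of finite asymptotic dimension that is
proper on all irreducible subgroups with integral characteristic. -/
theorem exists_length_finite_le {G : Subgroup (SpecialLinearGroup (Fin n) ℂ)} (hG : G.FG) :
    ∃ ℓ : G → ℝ, ℓ 1 = 0 ∧ (∀ g, 0 ≤ ℓ g) ∧ (∀ g, ℓ g⁻¹ = ℓ g) ∧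
      (∀ g h, ℓ (g * h) ≤ ℓ g + ℓ h) ∧
      HasBoundedMultiplicityPartitions (fun g h : G => ℓ (g⁻¹ * h)) ∧
      ∀ Γ : Subgroup G, HasIntegralCharacteristic (Γ.map G.subtype) →
        ActsIrreducibly (Γ.map G.subtype) → ∀ c : ℝ, {g : G | g ∈ Γ ∧ ℓ g ≤ c}.Finite := by
  obtain ⟨ι, _, ρ, hρ⟩ := exists_representations_finite_gauge_le hG
  have hlog (i : ι) (g : G) : 0 ≤ Real.log (ρ i g).gauge := Real.log_nonneg (Units.one_le_gauge _)
  refine ⟨fun g => ∑ i, Real.log (ρ i g).gauge, ?_, fun g => Finset.sum_nonneg fun i _ => hlog i g,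
    fun g => by simp only [map_inv, Units.gauge_inv], fun g h => ?_, ?_,
    fun Γ hint hirr c => (hρ Γ hint hirr (Real.exp c)).subset fun g hg => ⟨hg.1, fun i => ?_⟩⟩
  · have : (1 : (Matrix (Fin n) (Fin n) ℂ)ˣ).gauge = 1 :=
      le_antisymm ((gauge_diagonalUnits_le (d := 1) le_rfl (by simp) (by simp)).trans_eq'
        (by rw [map_one]))
        (Units.one_le_gauge _)
    simp [this]
  · rw [← Finset.sum_add_distrib]
    refine Finset.sum_le_sum fun i _ => ?_
    rw [map_mul, ← Real.log_mul (Units.gauge_pos _).ne' (Units.gauge_pos _).ne']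
    exact Real.log_le_log (Units.gauge_pos _) (Units.gauge_mul_le _ _)
  · refine .sum (fun i x y => hlog i _) fun i => ?_
    simpa only [map_mul, map_inv] using
      (hasBoundedMultiplicityPartitions_log_gauge n).comp (ρ i)
  -- All summands are non-negative, so a bound on the sum bounds each representation.
  · rw [← Real.log_le_iff_le_exp (Units.gauge_pos _)]
    exact (Finset.single_le_sum (fun j _ => hlog j g) (Finset.mem_univ i)).trans hg.2

theorem mainTheorem7 (n : ℕ) (G : Subgroup (Matrix.SpecialLinearGroup (Fin n) ℂ))
    (hG : G.FG) :
    ∃ (X : Type) (_ : MetricSpace X) (_ : Nonempty X) (_ : MulAction G X),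
      (∀ g : G, Isometry (fun x : X => g • x)) ∧
      HasFiniteAsdim X ∧
      ∀ Γ : Subgroup G,
        HasIntegralCharacteristic (Γ.map G.subtype) →
        ActsIrreducibly (Γ.map G.subtype) →
        IsMetricallyProperAction Γ X ∧ IsProperAction Γ X := by
  obtain ⟨ℓ, h1, h0, hinv, hmul, hpart, hfin⟩ := exists_length_finite_le hG
  obtain ⟨X, mX, neX, aX, hisom, hasdim, hproper⟩ :=
    exists_metricSpace_of_length ℓ h1 h0 hinv hmul hpart
  exact ⟨X, mX, neX, aX, hisom, hasdim, fun Γ hint hirr => hproper Γ (hfin Γ hint hirr)⟩
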